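/- Let $F$ be a field whose algebraic closure $\overline{F}$ is a finite extension of $F$, and let $n \ge 3$ be an integer. Let $\Gamma(M_n(F))$ be the commuting graph of the ring $M_n(F)$ of $n\times n$ matrices over $F$: its vertices are the non-central matrices in $M_n(F)$, and two distinct vertices $A$ and $B$ are adjacent if and only if $AB = BA$. Then $\Gamma(M_n(F))$ is connected and its diameter (the supremum of the distances between two vertices) is equal to $4$. -/

import Mathlib

/-- The commuting graph of a ring `R`: the vertices are the non-central elements of `R`, and two
distinct vertices are adjacent if and only if they commute. -/
def commutingGraph (R : Type*) [Ring R] : SimpleGraph {a : R // a ∉ Subring.center R} where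
  Adj a b := a ≠ b ∧ (a : R) * (b : R) = (b : R) * (a : R)
  symm := ⟨fun _ _ h => ⟨h.1.symm, h.2.symm⟩⟩
  loopless := ⟨fun _ h => h.1 rfl⟩

/-!
Every proper finite extension of a field `F` with `[F̄ : F] < ∞` contains `i = √-1`, and if there is
such an extension, then `i ∉ F` (Artin–Schreier). Hence a matrix without an eigenvalue in `F`
has a polynomial `J` in it with `J² = -1`, a complex structure, while a matrix with an eigenvalue
commutes with a rank-one matrix. In dimension at least three, any two matrices of these two kinds
commute with a common non-central matrix, so that all distances are at most `4`.

A distance at most `3` between a nilpotent Jordan block `N` and its transpose would give non-scalar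
polynomials `p(N)` and `q(Nᵀ)` that commute. Comparing two entries of the products shows that the
degree of `q` is below the order of `p` at `0`, and symmetrically, which is absurd.
-/

open Polynomial Module
open Matrix (vecMulVec)
open scoped Matrix

universe u v

section ArtinSchreier

variable {K L : Type*} [Field K] [Field L] [Algebra K L]

theorem exists_apply_ne_zero_of_isNilpotent {R M : Type*} [Ring R] [AddCommGroup M] [Module R M]
    {f : End R M} (hf : IsNilpotent f) (hf0 : f ≠ 0) : ∃ x, f x ≠ 0 ∧ f (f x) = 0 := by
  obtain ⟨k, hk⟩ := hf
  obtain ⟨m, hm, hm'⟩ := Nat.exists_not_and_succ_of_not_zero_of_exists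
    (p := fun m ↦ f ^ (m + 1) = 0) (by simpa using hf0) ⟨k, by rw [pow_succ, hk, zero_mul]⟩
  obtain ⟨x, hx⟩ := not_forall.1 fun h ↦ hm (LinearMap.ext h)
  refine ⟨(f ^ m) x, ?_, ?_⟩
  · rwa [← End.mul_apply, ← pow_succ']
  · rw [← End.mul_apply, ← End.mul_apply, ← pow_two, ← pow_add, add_comm, hm']
    rfl

theorem exists_algEquiv_apply_eq_add_one {p : ℕ} [Fact p.Prime] [CharP L p] {σ : Gal(L/K)}
    (hσ : orderOf σ = p) : ∃ y, σ y = y + 1 := by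
  have : CharP K p := (algebraMap K L).charP (algebraMap K L).injective p
  have : CharP (End K L) p := charP_of_injective_algebraMap (algebraMap K (End K L)).injective p
  -- `(σ - 1) ^ p = σ ^ p - 1 = 0` in characteristic `p`.
  have hnil : IsNilpotent (σ.toLinearMap - 1 : End K L) := by
    refine ⟨p, ?_⟩
    rw [sub_pow_char_of_commute p (Commute.one_right _), ← AlgEquiv.pow_toLinearMap, ← hσ,
      pow_orderOf_eq_one, one_pow]
    exact sub_self 1
  have hne : (σ.toLinearMap - 1 : End K L) ≠ 0 := by
    refine sub_ne_zero.2 fun h ↦ (Fact.out : p.Prime).ne_one ?_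
    rw [← hσ, orderOf_eq_one_iff]
    exact AlgEquiv.toLinearMap_injective h
  obtain ⟨x, hx, hxx⟩ := exists_apply_ne_zero_of_isNilpotent hnil hne
  set c := (σ.toLinearMap - 1 : End K L) x with hc
  have hσx : σ x = x + c := by simp [hc]
  have hσc : σ c = c := sub_eq_zero.1 hxx
  exact ⟨x / c, by rw [map_div₀, hσx, hσc, add_div, div_self hx]⟩

theorem surjective_pow_sub_self_of_isGalois [FiniteDimensional K L] [IsGalois K L] (p : ℕ)
    [Fact p.Prime] [CharP L p] (hL : Function.Surjective fun x : L ↦ x ^ p - x) :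
    Function.Surjective fun x : K ↦ x ^ p - x := by
  intro a
  obtain ⟨w, rfl⟩ := Algebra.trace_surjective K L a
  obtain ⟨z, rfl⟩ := hL w
  refine ⟨Algebra.trace K L z, (algebraMap K L).injective ?_⟩
  simp only [map_sub, map_pow, trace_eq_sum_automorphisms, sum_pow_char]

theorem surjective_pow_sub_self (L : Type*) [Field L] [IsAlgClosed L] {p : ℕ}
    (hp : 1 < p) : Function.Surjective fun x : L ↦ x ^ p - x := by
  intro a
  have hdeg : (X ^ p - X - C a : L[X]).natDegree = p := by
    rw [natDegree_sub_C, FiniteField.X_pow_card_sub_X_natDegree_eq L hp]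
  obtain ⟨x, hx⟩ := IsAlgClosed.exists_root _
    (degree_ne_of_natDegree_ne (n := 0) (hdeg ▸ Nat.ne_zero_of_lt hp))
  exact ⟨x, sub_eq_zero.1 (by simpa using hx)⟩

theorem finrank_ne_char_of_isAlgClosed [IsGalois K L] [IsAlgClosed L] {p : ℕ} (hp : p.Prime)
    [CharP L p] : finrank K L ≠ p := by
  intro hKL
  have := Fact.mk hp
  have : FiniteDimensional K L := .of_finrank_pos (hKL ▸ hp.pos)
  have hcard : Nat.card Gal(L/K) = p := by rw [IsGalois.card_aut_eq_finrank, hKL]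
  obtain ⟨σ, hσ⟩ := exists_prime_orderOf_dvd_card' (G := Gal(L/K)) p hcard.symm.dvd
  obtain ⟨y, hy⟩ := exists_algEquiv_apply_eq_add_one hσ
  have hσ1 : σ ≠ 1 := fun h ↦ hp.one_lt.ne (by rw [← hσ, h, orderOf_one])
  have hfix : σ (y ^ p - y) = y ^ p - y := by
    simp only [map_sub, map_pow, hy, add_pow_char, one_pow]
    ring
  obtain ⟨a, ha⟩ : y ^ p - y ∈ Set.range (algebraMap K L) :=
    (IsGalois.mem_range_algebraMap_iff_fixed _).2 fun f ↦
      (Subgroup.zpowers_le (H := MulAction.stabilizer Gal(L/K) (y ^ p - y))).2 hfix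
        (mem_zpowers_of_prime_card hcard hσ1)
  obtain ⟨b, rfl⟩ := surjective_pow_sub_self_of_isGalois p (surjective_pow_sub_self L hp.one_lt) a
  -- `y - b` lies in the prime field, so it is fixed by `σ`.
  have hyb : y - algebraMap K L b ∈ (⊥ : Subfield L) := by
    rw [Subfield.mem_bot_iff_pow_eq_self L p, sub_pow_char, ← map_pow]
    rw [map_sub] at ha
    linear_combination -ha
  have hσyb : σ (y - algebraMap K L b) = y - algebraMap K L b :=
    (bot_le : (⊥ : Subfield L) ≤ (σ : L →+* L).eqLocusField (RingHom.id L)) hyb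
  rw [map_sub, hy, σ.commutes] at hσyb
  exact one_ne_zero (α := L) (by linear_combination hσyb)

theorem isPrimitiveRoot_mem_range_algebraMap {p : ℕ} (hp : p.Prime) (hKL : finrank K L = p)
    {ζ : L} (hζ : IsPrimitiveRoot ζ p) : ζ ∈ (algebraMap K L).range := by
  have : FiniteDimensional K L := .of_finrank_pos (hKL ▸ hp.pos)
  rw [← minpoly.natDegree_eq_one_iff (A := K)]
  have hle : (minpoly K ζ).natDegree ≤ p - 1 := by
    rw [← Nat.totient_prime hp, ← natDegree_cyclotomic p K]
    have := hζ.isRoot_cyclotomic hp.pos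
    refine natDegree_le_of_dvd (minpoly.dvd K ζ ?_) (cyclotomic_ne_zero p K)
    rwa [aeval_def, ← eval_map, map_cyclotomic]
  have hdvd : (minpoly K ζ).natDegree ∣ p :=
    hKL ▸ minpoly.degree_dvd (Algebra.IsIntegral.isIntegral ζ)
  exact (hp.eq_one_or_self_of_dvd _ hdvd).resolve_right (by have := hp.pos; omega)

theorem norm_eq_of_irreducible_X_pow_sub_C {n : ℕ} {a : K} (h : Irreducible (X ^ n - C a))
    {α : L} (hα : α ^ n = algebraMap K L a)
    (htop : IntermediateField.adjoin K {α} = ⊤) :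
    Algebra.norm K α = (-1) ^ n * -a := by
  have hn : n ≠ 0 := by
    rintro rfl
    rw [pow_zero, ← C_1, ← C_sub] at h
    exact not_irreducible_C _ h
  have hmin : minpoly K α = X ^ n - C a :=
    (minpoly.eq_of_irreducible_of_monic h (by simp [hα]) (monic_X_pow_sub_C a hn)).symm
  have hint : IsIntegral K α := ⟨_, monic_X_pow_sub_C a hn, by simp [hα]⟩
  have hadj : Algebra.adjoin K {α} = ⊤ := by
    rw [← IntermediateField.adjoin_simple_toSubalgebra_of_isAlgebraic hint.isAlgebraic, htop]
    rfl
  have hnorm :=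
    Algebra.PowerBasis.norm_gen_eq_coeff_zero_minpoly (PowerBasis.ofAdjoinEqTop hint hadj)
  rw [← PowerBasis.natDegree_minpoly, PowerBasis.ofAdjoinEqTop_gen, hmin] at hnorm
  simpa [natDegree_X_pow_sub_C, hn.symm] using hnorm

theorem exists_pow_eq_neg_one_of_isSquare (hi : IsSquare (-1 : K)) {p : ℕ} (hp : p.Prime) :
    ∃ c : K, c ^ p = -1 := by
  obtain rfl | hodd := hp.eq_two_or_odd'
  · exact (isSquare_iff_exists_sq _).1 hi |>.imp fun _ ↦ Eq.symm
  · exact ⟨-1, hodd.neg_one_pow⟩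

theorem finrank_ne_prime_of_isAlgClosed [IsGalois K L] [IsAlgClosed L] (hi : IsSquare (-1 : K))
    {p : ℕ} (hp : p.Prime) (hpK : (p : K) ≠ 0) : finrank K L ≠ p := by
  intro hKL
  have := Fact.mk hp
  have : FiniteDimensional K L := .of_finrank_pos (hKL ▸ hp.pos)
  have hcard : Nat.card Gal(L/K) = p := by rw [IsGalois.card_aut_eq_finrank, hKL]
  have := isCyclic_of_prime_card hcard
  have : NeZero (p : L) := ⟨by simpa using (map_ne_zero (algebraMap K L)).2 hpK⟩
  obtain ⟨ζ, hζ⟩ := HasEnoughRootsOfUnity.exists_primitiveRoot L p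
  obtain ⟨ζ', rfl⟩ := isPrimitiveRoot_mem_range_algebraMap hp hKL hζ
  have hζ' : IsPrimitiveRoot ζ' p := hζ.of_map_of_injective (algebraMap K L).injective
  obtain ⟨α, ⟨a, ha⟩, hα⟩ := exists_root_adjoin_eq_top_of_isCyclic K L
    ⟨ζ', by rw [hKL]; exact (mem_primitiveRoots hp.pos).2 hζ'⟩
  have hirr := irreducible_X_pow_sub_C_of_root_adjoin_eq_top ha.symm hα
  rw [hKL] at ha hirr
  obtain ⟨β, hβ⟩ := IsAlgClosed.exists_pow_nat_eq α hp.pos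
  obtain ⟨c, hc⟩ := exists_pow_eq_neg_one_of_isSquare hi hp
  -- As `β ^ p = α`, the `p`-th power of the norm of `β` is the norm of `α`, which is `± a`.
  refine pow_ne_of_irreducible_X_pow_sub_C hirr dvd_rfl hp.ne_one
    (c ^ (p + 1) * Algebra.norm K β) ?_
  rw [mul_pow, ← map_pow, hβ, norm_eq_of_irreducible_X_pow_sub_C hirr ha.symm hα,
    pow_right_comm, hc]
  ring_nf
  simp [mul_comm p 2, pow_mul]

theorem isSeparable_of_isAlgClosed [FiniteDimensional K L] [IsAlgClosed L] :
    Algebra.IsSeparable K L := by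
  rw [← separableClosure.eq_top_iff, eq_top_iff]
  rintro x -
  obtain ⟨q, _⟩ := ExpChar.exists (separableClosure K L)
  obtain ⟨z, rfl⟩ := IsAlgClosed.exists_pow_nat_eq x
    (pow_pos (expChar_pos (separableClosure K L) q)
      (IsPurelyInseparable.exponent (separableClosure K L) L))
  obtain ⟨y, hy⟩ := IsPurelyInseparable.exponent_def' (separableClosure K L) q z
  exact hy ▸ y.2

theorem finrank_eq_one_of_isAlgClosed [FiniteDimensional K L] [IsAlgClosed L]
    (hi : IsSquare (-1 : K)) : finrank K L = 1 := by
  have := isSeparable_of_isAlgClosed (K := K) (L := L)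
  have : Normal K L := ⟨fun x ↦ IsAlgClosed.splits _⟩
  have : IsGalois K L := ⟨⟩
  by_contra hne
  rw [← IsGalois.card_aut_eq_finrank] at hne
  obtain ⟨p, hp, hdvd⟩ := Nat.exists_prime_and_dvd hne
  have := Fact.mk hp
  obtain ⟨σ, hσ⟩ := exists_prime_orderOf_dvd_card' p hdvd
  let E := IntermediateField.fixedField (Subgroup.zpowers σ)
  have hEL : finrank E L = p := by
    rw [IntermediateField.finrank_fixedField_eq_card, Nat.card_zpowers, hσ]
  by_cases hpE : (p : E) = 0
  · have : CharP E p := (CharP.charP_iff_prime_eq_zero hp).2 hpE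
    have : CharP L p := charP_of_injective_algebraMap (algebraMap E L).injective p
    exact absurd hEL (finrank_ne_char_of_isAlgClosed hp)
  · exact finrank_ne_prime_of_isAlgClosed (by simpa using hi.map (algebraMap K E)) hp hpE hEL

theorem finrank_le_two_of_isAlgClosed [FiniteDimensional K L] [IsAlgClosed L] :
    finrank K L ≤ 2 := by
  obtain ⟨i, hi⟩ := IsAlgClosed.exists_pow_nat_eq (-1 : L) two_pos
  have hroot : aeval i (X ^ 2 + C 1 : K[X]) = 0 := by simp [hi]
  have hmonic : (X ^ 2 + C 1 : K[X]).Monic := monic_X_pow_add_C 1 two_ne_zero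
  have hsq : IsSquare (-1 : IntermediateField.adjoin K {i}) :=
    ⟨IntermediateField.AdjoinSimple.gen K i, Subtype.ext (by simp [← pow_two, hi])⟩
  calc finrank K L = finrank K (IntermediateField.adjoin K {i}) := by
        rw [← finrank_mul_finrank K (IntermediateField.adjoin K {i}) L,
          finrank_eq_one_of_isAlgClosed hsq, mul_one]
    _ = (minpoly K i).natDegree :=
        IntermediateField.adjoin.finrank ⟨_, hmonic, by simpa using hroot⟩
    _ ≤ (X ^ 2 + C 1 : K[X]).natDegree :=
        natDegree_le_of_dvd (minpoly.dvd K i hroot) hmonic.ne_zero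
    _ = 2 := natDegree_X_pow_add_C

end ArtinSchreier

section ProperExtensions

/-- A condition on a field `F` under which a matrix without eigenvalues generates a square root of
`-1`: every finite extension of `F` of degree at least two contains such a root, and `F` does not if
it has such an extension. It holds for algebraically closed and real closed fields, but also for the
union of the fields `𝔽_{3^m}` with `m` odd. The extensions range over the universe of `F`, which
contains copies of all of them. -/
def ProperExtensionsContainSqrtNegOne (F : Type u) [Field F] : Prop :=
  ∀ (K : Type u) [Field K] [Algebra F K] [FiniteDimensional F K],
    Module.finrank F K ≠ 1 → ¬ IsSquare (-1 : F) ∧ IsSquare (-1 : K)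

theorem bijective_algebraMap_of_finrank_eq_one {F A : Type*} [Field F] [Ring A] [Algebra F A]
    (h : finrank F A = 1) : Function.Bijective (algebraMap F A) :=
  have := finite_of_finrank_eq_succ h
  bijective_algebraMap_of_linearEquiv (LinearEquiv.ofFinrankEq F A (by rw [h, finrank_self]))

theorem properExtensionsContainSqrtNegOne_of_isAlgClosed {F : Type u} (L : Type v) [Field F]
    [Field L] [Algebra F L] [FiniteDimensional F L] [IsAlgClosed L] :
    ProperExtensionsContainSqrtNegOne F := by
  intro K _ _ _ hK
  let f : K →ₐ[F] L := IsAlgClosed.lift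
  algebraize [f.toRingHom]
  have : IsScalarTower F K L := .of_algebraMap_eq fun x ↦ (f.commutes x).symm
  have : FiniteDimensional K L := .right F K L
  have hmul : finrank F K * finrank K L = finrank F L := finrank_mul_finrank F K L
  have hFK : 0 < finrank F K := finrank_pos
  have hKL : 0 < finrank K L := finrank_pos
  constructor
  · intro hF
    rw [finrank_eq_one_of_isAlgClosed (L := L) hF] at hmul
    exact hK (Nat.eq_one_of_mul_eq_one_right hmul)
  · have hKL1 : finrank K L = 1 := by
      have : finrank F L ≤ 2 := finrank_le_two_of_isAlgClosed
      nlinarith [show 2 ≤ finrank F K by omega]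
    obtain ⟨i, hi⟩ := IsAlgClosed.exists_pow_nat_eq (-1 : L) two_pos
    obtain ⟨j, rfl⟩ := (bijective_algebraMap_of_finrank_eq_one hKL1).2 i
    exact ⟨j, (algebraMap K L).injective (by simp [← pow_two, hi])⟩

theorem isSquare_of_isNilpotent_pow_two_sub {R : Type*} [CommRing R] (h2 : IsUnit (2 : R))
    {a b : R} (ha : IsUnit a) (h : IsNilpotent (b ^ 2 - a)) : IsSquare a := by
  have hb : IsUnit b := by
    refine isUnit_of_mul_isUnit_left (y := b) ?_
    rw [← pow_two, ← sub_add_cancel (b ^ 2) a]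
    exact h.isUnit_add_right_of_commute ha (Commute.all _ _)
  obtain ⟨c, ⟨-, hc⟩, -⟩ := Polynomial.existsUnique_nilpotent_sub_and_aeval_eq_zero
    (P := (X ^ 2 - C a : R[X])) (x := b) (by simpa using h)
    (by simpa [derivative_X_pow, one_add_one_eq_two] using h2.mul hb)
  exact (isSquare_iff_exists_sq a).2 ⟨c, by simpa using (sub_eq_zero.1 (by simpa using hc)).symm⟩

theorem isSquare_of_forall_maximalSpectrum {R : Type*} [CommRing R] [IsArtinianRing R]
    (h2 : IsUnit (2 : R)) {a : R} (ha : IsUnit a)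
    (h : ∀ m : MaximalSpectrum R, IsSquare (Ideal.Quotient.mk m.asIdeal a)) : IsSquare a := by
  choose s hs using h
  let e := IsArtinianRing.quotNilradicalEquivPi R
  obtain ⟨b, hb⟩ := Ideal.Quotient.mk_surjective (e.symm s)
  refine isSquare_of_isNilpotent_pow_two_sub h2 ha (b := b) ?_
  rw [← mem_nilradical, ← Ideal.Quotient.eq]
  apply e.injective
  funext m
  rw [map_pow, hb, map_pow, e.apply_symm_apply, Pi.pow_apply, pow_two, ← hs]
  rfl

theorem exists_isRoot_of_finrank_eq_one {F A : Type*} [Field F] [Ring A] [Algebra F A]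
    (h : finrank F A = 1) {p : F[X]} {x : A} (hx : aeval x p = 0) : ∃ r, p.IsRoot r := by
  obtain ⟨hinj, hsurj⟩ := bijective_algebraMap_of_finrank_eq_one h
  obtain ⟨r, rfl⟩ := hsurj x
  exact ⟨r, hinj (by rwa [map_zero, ← aeval_algebraMap_apply_eq_algebraMap_eval])⟩

theorem ProperExtensionsContainSqrtNegOne.exists_dvd_sq_add_one {F : Type u} [Field F]
    (hF : ProperExtensionsContainSqrtNegOne F) {m : F[X]} (hm : m.degree ≠ 0)
    (hroot : ∀ r, ¬ m.IsRoot r) : ¬ IsSquare (-1 : F) ∧ ∃ q, m ∣ q ^ 2 + 1 := by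
  have hm0 : m ≠ 0 := by
    rintro rfl
    exact hroot 0 (by simp)
  have : FiniteDimensional F (AdjoinRoot m) := (AdjoinRoot.powerBasis hm0).finite
  have : IsArtinianRing (AdjoinRoot m) := IsArtinianRing.of_finite F (AdjoinRoot m)
  have : Nontrivial (AdjoinRoot m) := AdjoinRoot.nontrivial m hm
  have hresidue (I : MaximalSpectrum (AdjoinRoot m)) :
      ¬ IsSquare (-1 : F) ∧ IsSquare (Ideal.Quotient.mk I.asIdeal (-1)) := by
    have := I.isMaximal
    let _ := Ideal.Quotient.field I.asIdeal
    have hx : aeval (Ideal.Quotient.mkₐ F I.asIdeal (AdjoinRoot.root m)) m = 0 := by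
      rw [aeval_algHom_apply, AdjoinRoot.aeval_eq, AdjoinRoot.mk_self, map_zero]
    rw [map_neg, map_one]
    exact hF (AdjoinRoot m ⧸ I.asIdeal) fun h ↦
      (exists_isRoot_of_finrank_eq_one h hx).elim hroot
  obtain ⟨I⟩ : Nonempty (MaximalSpectrum (AdjoinRoot m)) := inferInstance
  have hi := (hresidue I).1
  have h2 : (2 : F) ≠ 0 := fun h ↦ hi ⟨1, by linear_combination -h⟩
  obtain ⟨y, hy⟩ := isSquare_of_forall_maximalSpectrum (R := AdjoinRoot m) (a := -1)
    (by simpa only [map_ofNat] using h2.isUnit.map (algebraMap F (AdjoinRoot m)))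
    isUnit_one.neg fun I ↦ (hresidue I).2
  obtain ⟨q, rfl⟩ := AdjoinRoot.mk_surjective y
  refine ⟨hi, q, ?_⟩
  rw [← AdjoinRoot.mk_eq_zero]
  simp [pow_two, ← hy]

end ProperExtensions

section Anticommutation

variable {R : Type*} [Ring R] {a b c : R}

theorem commute_mul_add_mul_of_commute_mul_self (h : Commute (a * a) b) :
    Commute a (a * b + b * a) := by
  rw [Commute, SemiconjBy] at h ⊢
  rw [mul_add, add_mul, ← mul_assoc, h]
  noncomm_ring

theorem commute_mul_mul_sub_mul_of_commute_mul_self (hb : SemiconjBy a b (-b))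
    (h : Commute (b * b) c) : Commute b (a * (b * c - c * b)) := by
  rw [Commute, SemiconjBy] at *
  have hb' : b * a = -(a * b) := by rw [hb, neg_mul, neg_neg]
  calc b * (a * (b * c - c * b)) = a * (b * c * b - b * b * c) := by
        rw [← mul_assoc, hb']; noncomm_ring
    _ = a * (b * c - c * b) * b := by rw [h]; noncomm_ring

theorem commute_mul_of_semiconjBy_neg (hb : SemiconjBy a b (-b)) (hc : SemiconjBy a c (-c)) :
    Commute a (b * c) :=
  (neg_mul_neg b c) ▸ hb.mul_right hc

theorem commute_sub_mul_mul_of_mul_self (ha : a * a = -1) : Commute a (b - a * b * a) :=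
  calc a * (b - a * b * a) = a * b - a * a * b * a := by noncomm_ring
    _ = b * a - a * b * (a * a) := by rw [ha]; noncomm_ring
    _ = (b - a * b * a) * a := by noncomm_ring

theorem semiconjBy_add_mul_mul_of_mul_self (ha : a * a = -1) :
    SemiconjBy a (b + a * b * a) (-(b + a * b * a)) :=
  calc a * (b + a * b * a) = a * b + a * a * b * a := by noncomm_ring
    _ = -(b * a + a * b * (a * a)) := by rw [ha]; noncomm_ring
    _ = -(b + a * b * a) * a := by noncomm_ring

end Anticommutation

section Matrix

variable {n R : Type*} [Fintype n] [DecidableEq n] [CommRing R]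

theorem exists_eq_smul_one_of_mem_center {M : Matrix n n R}
    (hM : M ∈ Subring.center (Matrix n n R)) : ∃ a : R, M = a • 1 := by
  obtain ⟨a, ha⟩ := Matrix.mem_range_scalar_of_commute_single (M := M)
    fun i j _ ↦ Subring.mem_center_iff.1 hM _
  exact ⟨a, by rw [← ha, Matrix.scalar_apply, Matrix.smul_one_eq_diagonal]⟩

theorem notMem_center_of_mulVec_eq_zero [IsDomain R] {M : Matrix n n R} (hM : M ≠ 0) {w : n → R}
    (hw : w ≠ 0) (h : M *ᵥ w = 0) : M ∉ Subring.center (Matrix n n R) := by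
  intro hc
  obtain ⟨a, rfl⟩ := exists_eq_smul_one_of_mem_center hc
  rw [Matrix.smul_mulVec, Matrix.one_mulVec, smul_eq_zero, or_iff_left hw] at h
  exact hM (by rw [h, zero_smul])

omit [DecidableEq n] in
theorem commute_vecMulVec_of_mulVec_eq_smul {M : Matrix n n R} {x f : n → R} {r : R}
    (hx : M *ᵥ x = r • x) (hf : f ᵥ* M = r • f) : Commute (vecMulVec x f) M := by
  rw [Commute, SemiconjBy, Matrix.mul_vecMulVec, Matrix.vecMulVec_mul, hx, hf,
    Matrix.smul_vecMulVec, Matrix.vecMulVec_smul]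

omit [DecidableEq n] in
theorem commute_transpose_iff {M N : Matrix n n R} : Commute Mᵀ Nᵀ ↔ Commute M N := by
  rw [Commute, SemiconjBy, ← Matrix.transpose_mul, ← Matrix.transpose_mul, Matrix.transpose_inj]
  exact eq_comm

theorem transpose_mem_center_iff {M : Matrix n n R} :
    Mᵀ ∈ Subring.center (Matrix n n R) ↔ M ∈ Subring.center (Matrix n n R) := by
  simp only [Subring.mem_center_iff]
  refine ⟨fun h N ↦ commute_transpose_iff.1 (h Nᵀ), fun h N ↦ ?_⟩
  rw [← N.transpose_transpose]
  exact commute_transpose_iff.2 (h Nᵀ)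

end Matrix

section ComplexStructure

variable {n F : Type*} [Fintype n] [DecidableEq n] [Field F] {J K : Matrix n n F}

omit [DecidableEq n] in
theorem exists_ne_zero_and_dotProduct_eq_zero_and
    (hn : 3 ≤ Fintype.card n) (f g : n → F) : ∃ z : n → F, z ≠ 0 ∧ f ⬝ᵥ z = 0 ∧ g ⬝ᵥ z = 0 := by
  have hker : LinearMap.ker (Matrix.mulVecLin (Matrix.of ![f, g])) ≠ ⊥ := by
    apply LinearMap.ker_ne_bot_of_finrank_lt
    simp only [Module.finrank_fintype_fun_eq_card, Fintype.card_fin]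
    omega
  obtain ⟨z, hz, hz0⟩ := Submodule.exists_mem_ne_zero_of_ne_bot hker
  rw [LinearMap.mem_ker, Matrix.mulVecLin_apply] at hz
  exact ⟨z, hz0, congrFun hz 0, congrFun hz 1⟩

theorem exists_notMem_center_commute_vecMulVec
    (hn : 3 ≤ Fintype.card n) {x : n → F} (hx : x ≠ 0) (f y g : n → F) :
    ∃ Z ∉ Subring.center (Matrix n n F),
      Commute (vecMulVec x f) Z ∧ Commute (vecMulVec y g) Z := by
  obtain ⟨z, hz, hfz, hgz⟩ := exists_ne_zero_and_dotProduct_eq_zero_and hn f g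
  obtain ⟨h, hh, hxh, hyh⟩ := exists_ne_zero_and_dotProduct_eq_zero_and hn x y
  rw [dotProduct_comm] at hxh hyh
  have hZx : vecMulVec z h *ᵥ x = 0 := by simp [Matrix.vecMulVec_mulVec, hxh]
  refine ⟨vecMulVec z h,
    notMem_center_of_mulVec_eq_zero (Matrix.vecMulVec_ne_zero hz hh) hx hZx,
    commute_vecMulVec_of_mulVec_eq_smul (r := 0) ?_ ?_,
    commute_vecMulVec_of_mulVec_eq_smul (r := 0) ?_ ?_⟩ <;>
  simp [Matrix.vecMulVec_mulVec, Matrix.vecMul_vecMulVec, hxh, hyh, hfz, hgz]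

theorem eq_zero_of_smul_add_smul_mulVec_eq_zero (hF : ¬ IsSquare (-1 : F)) (hJ : J * J = -1)
    {w : n → F} (hw : w ≠ 0) {s r : F} (h : s • w + r • (J *ᵥ w) = 0) : s = 0 ∧ r = 0 := by
  have hJw : J *ᵥ (J *ᵥ w) = -w := by
    rw [Matrix.mulVec_mulVec, hJ, Matrix.neg_mulVec, Matrix.one_mulVec]
  have hJh : s • (J *ᵥ w) - r • w = 0 := by
    simpa [Matrix.mulVec_add, Matrix.mulVec_smul, hJw, ← sub_eq_add_neg] using congrArg (J *ᵥ ·) h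
  have hsr : s * s + r * r = 0 := by
    refine (smul_eq_zero.1 (?_ : (s * s + r * r) • w = 0)).resolve_right hw
    calc (s * s + r * r) • w
        = s • (s • w + r • (J *ᵥ w)) - r • (s • (J *ᵥ w) - r • w) := by module
      _ = 0 := by rw [h, hJh, smul_zero, smul_zero, sub_zero]
  have hr : r = 0 := by
    by_contra hr
    exact hF ⟨s / r, by field_simp; linear_combination -hsr⟩
  exact ⟨by simpa [hr] using hsr, hr⟩

theorem notMem_center_of_mul_self_eq_neg_one [Nonempty n] (hF : ¬ IsSquare (-1 : F))
    (hJ : J * J = -1) : J ∉ Subring.center (Matrix n n F) := by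
  intro hc
  obtain ⟨a, rfl⟩ := exists_eq_smul_one_of_mem_center hc
  exact one_ne_zero (α := F) (eq_zero_of_smul_add_smul_mulVec_eq_zero hF hJ one_ne_zero
    (s := -a) (r := 1) (by simp [Matrix.smul_mulVec])).2

theorem vecMulVec_sub_mul_vecMulVec_mul_ne_zero (hF : ¬ IsSquare (-1 : F)) (hJ : J * J = -1)
    {u f : n → F} (hu : u ≠ 0) (hf : f ≠ 0) :
    vecMulVec u f - J * vecMulVec u f * J ≠ 0 := by
  intro h
  rw [Matrix.mul_vecMulVec, Matrix.vecMulVec_mul] at h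
  obtain ⟨j, hj⟩ := Function.ne_iff.1 hf
  refine hj (eq_zero_of_smul_add_smul_mulVec_eq_zero hF hJ hu (r := -(f ᵥ* J) j) ?_).1
  ext i
  simpa [Matrix.vecMulVec_apply, mul_comm, sub_eq_add_neg] using congrFun (congrFun h i) j

theorem exists_notMem_center_commute_vecMulVec_of_mul_self
    (hn : 3 ≤ Fintype.card n) (hF : ¬ IsSquare (-1 : F)) (hJ : J * J = -1)
    {x : n → F} (hx : x ≠ 0) (f : n → F) :
    ∃ Z ∉ Subring.center (Matrix n n F), Commute (vecMulVec x f) Z ∧ Commute J Z := by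
  obtain ⟨z, hz, hfz, hfJz⟩ := exists_ne_zero_and_dotProduct_eq_zero_and hn f (f ᵥ* J)
  obtain ⟨h, hh, hxh, hJxh⟩ := exists_ne_zero_and_dotProduct_eq_zero_and hn x (J *ᵥ x)
  rw [dotProduct_comm] at hxh hJxh
  rw [← Matrix.dotProduct_mulVec] at hfJz
  set Z := vecMulVec z h - J * vecMulVec z h * J with hZ
  have hZx : Z *ᵥ x = 0 := by
    simp [hZ, Matrix.sub_mulVec, ← Matrix.mulVec_mulVec, Matrix.vecMulVec_mulVec, hxh, hJxh]
  have hfZ : f ᵥ* Z = 0 := by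
    simp [hZ, Matrix.vecMul_sub, Matrix.mul_vecMulVec, Matrix.vecMulVec_mul,
      Matrix.vecMul_vecMulVec, hfz, hfJz]
  exact ⟨Z, notMem_center_of_mulVec_eq_zero
      (vecMulVec_sub_mul_vecMulVec_mul_ne_zero hF hJ hz hh) hx hZx,
    commute_vecMulVec_of_mulVec_eq_smul (r := 0) (by simpa using hZx) (by simpa using hfZ),
    commute_sub_mul_mul_of_mul_self hJ⟩

theorem exists_semiconjBy_neg_and_mul_ne_zero (hn : 3 ≤ Fintype.card n)
    (hF : ¬ IsSquare (-1 : F)) (hJ : J * J = -1) {Y : Matrix n n F} (hY : Y ≠ 0)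
    (hJY : SemiconjBy J Y (-Y)) :
    ∃ T, SemiconjBy J T (-T) ∧ Y * T ≠ 0 ∧ ∃ w ≠ 0, T *ᵥ w = 0 := by
  obtain ⟨v, hYv⟩ : ∃ v, Y *ᵥ v ≠ 0 := by
    by_contra! h
    exact hY (Matrix.ext_of_mulVec_single fun i ↦ by rw [h, Matrix.zero_mulVec])
  have hv : v ≠ 0 := by
    rintro rfl
    exact hYv (Matrix.mulVec_zero Y)
  obtain ⟨w, hw, hvw, hvJw⟩ := exists_ne_zero_and_dotProduct_eq_zero_and hn v (v ᵥ* J)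
  rw [← Matrix.dotProduct_mulVec] at hvJw
  refine ⟨vecMulVec v v + J * vecMulVec v v * J, semiconjBy_add_mul_mul_of_mul_self hJ,
    ?_, w, hw, ?_⟩
  · have hYJ : Y * J = -(J * Y) := by rw [hJY.eq, neg_mul, neg_neg]
    have hYT : Y * (vecMulVec v v + J * vecMulVec v v * J) =
        vecMulVec (Y *ᵥ v) v - J * vecMulVec (Y *ᵥ v) v * J := by
      rw [← Matrix.mul_vecMulVec, mul_add, ← mul_assoc, ← mul_assoc, hYJ]
      noncomm_ring
    exact hYT ▸ vecMulVec_sub_mul_vecMulVec_mul_ne_zero hF hJ hYv hv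
  · simp [Matrix.add_mulVec, ← Matrix.mulVec_mulVec, Matrix.vecMulVec_mulVec, hvw, hvJw]

theorem mul_eq_zero_of_mem_center (hF : ¬ IsSquare (-1 : F)) (hJ : J * J = -1)
    {Y T : Matrix n n F} {w : n → F} (hw : w ≠ 0) (hTw : T *ᵥ w = 0)
    (hadd : Y * T + T * Y ∈ Subring.center (Matrix n n F))
    (hsub : J * (Y * T - T * Y) ∈ Subring.center (Matrix n n F)) : Y * T = 0 := by
  obtain ⟨s, hs⟩ := exists_eq_smul_one_of_mem_center hadd
  obtain ⟨r, hr⟩ := exists_eq_smul_one_of_mem_center hsub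
  have h2YT : (2 : F) • (Y * T) = s • 1 - r • J := by
    calc (2 : F) • (Y * T) = (Y * T + T * Y) - J * J * (Y * T - T * Y) := by
          rw [hJ, ofNat_smul_eq_nsmul]; noncomm_ring
      _ = s • 1 - r • J := by rw [hs, mul_assoc, hr, Matrix.mul_smul, mul_one]
  have h0 : s • w + (-r) • (J *ᵥ w) = 0 := by
    have h := congrArg (· *ᵥ w) h2YT
    simp only [Matrix.sub_mulVec, Matrix.smul_mulVec, Matrix.one_mulVec, ← Matrix.mulVec_mulVec,
      hTw, Matrix.mulVec_zero, smul_zero] at h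
    rw [neg_smul, ← sub_eq_add_neg, ← h]
  obtain ⟨rfl, hr0⟩ := eq_zero_of_smul_add_smul_mulVec_eq_zero hF hJ hw h0
  rw [neg_eq_zero.1 hr0, zero_smul, zero_smul, sub_zero, smul_eq_zero] at h2YT
  exact h2YT.resolve_left fun h2 ↦ hF ⟨1, by linear_combination -h2⟩

theorem exists_notMem_center_commute_of_semiconjBy_neg (hn : 3 ≤ Fintype.card n)
    (hF : ¬ IsSquare (-1 : F)) (hJ : J * J = -1) {Y : Matrix n n F} (hY : Y ≠ 0)
    (hJY : SemiconjBy J Y (-Y)) (hYY : ∀ T, Commute (Y * Y) T) :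
    ∃ Z ∉ Subring.center (Matrix n n F), Commute J Z ∧ Commute Y Z := by
  -- `Y T + T Y` and `J (Y T - T Y)` commute with both `J` and `Y`.
  obtain ⟨T, hJT, hYT, w, hw, hTw⟩ := exists_semiconjBy_neg_and_mul_ne_zero hn hF hJ hY hJY
  have hJYT : Commute J (Y * T) := commute_mul_of_semiconjBy_neg hJY hJT
  have hJTY : Commute J (T * Y) := commute_mul_of_semiconjBy_neg hJT hJY
  by_cases hadd : Y * T + T * Y ∈ Subring.center (Matrix n n F)
  · refine ⟨J * (Y * T - T * Y), fun hsub ↦ ?_,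
      (Commute.refl J).mul_right (hJYT.sub_right hJTY),
      commute_mul_mul_sub_mul_of_commute_mul_self hJY (hYY T)⟩
    exact hYT (mul_eq_zero_of_mem_center hF hJ hw hTw hadd hsub)
  · exact ⟨Y * T + T * Y, hadd, hJYT.add_right hJTY,
      commute_mul_add_mul_of_commute_mul_self (hYY T)⟩

theorem exists_notMem_center_commute_of_mul_self (hn : 3 ≤ Fintype.card n)
    (hF : ¬ IsSquare (-1 : F)) (hJ : J * J = -1) (hK : K * K = -1) :
    ∃ Z ∉ Subring.center (Matrix n n F), Commute J Z ∧ Commute K Z := by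
  have : Nonempty n := Fintype.card_pos_iff.1 (by omega)
  have h2 : (2 : F) ≠ 0 := fun h ↦ hF ⟨1, by linear_combination -h⟩
  by_cases hS : J * K + K * J ∈ Subring.center (Matrix n n F)
  swap
  · refine ⟨_, hS, commute_mul_add_mul_of_commute_mul_self (by simp [hJ]), ?_⟩
    rw [add_comm]
    exact commute_mul_add_mul_of_commute_mul_self (by simp [hK])
  obtain ⟨c, hc⟩ := exists_eq_smul_one_of_mem_center hS
  -- The part of `K` that anticommutes with `J`, up to a factor of two.
  set Y := K + J * K * J with hY
  have hJY : SemiconjBy J Y (-Y) := semiconjBy_add_mul_mul_of_mul_self hJ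
  have hYK : Y = (2 : F) • K + c • J := by
    calc Y = (J * K + K * J) * J + (K - K * (J * J)) := by rw [hY]; noncomm_ring
      _ = (2 : F) • K + c • J := by
        rw [hc, hJ, Matrix.smul_mul, one_mul, ofNat_smul_eq_nsmul]; noncomm_ring
  have hK_comm {Z : Matrix n n F} (hJZ : Commute J Z) (hYZ : Commute Y Z) : Commute K Z := by
    have hKY : K = (2 : F)⁻¹ • (Y - c • J) := by
      rw [hYK, add_sub_cancel_right, inv_smul_smul₀ h2]
    rw [hKY]
    exact (hYZ.sub_left (hJZ.smul_left c)).smul_left _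
  by_cases hY0 : Y = 0
  · exact ⟨J, notMem_center_of_mul_self_eq_neg_one hF hJ, Commute.refl J,
      hK_comm (Commute.refl J) (hY0 ▸ Commute.zero_left J)⟩
  · have hYY : Y * Y = (c * c - 4) • 1 := by
      calc Y * Y = (4 : F) • (K * K) + (2 * c) • (J * K + K * J) + (c * c) • (J * J) := by
            simp only [hYK, add_mul, mul_add, Matrix.smul_mul, Matrix.mul_smul]
            module
        _ = (c * c - 4) • 1 := by
            rw [hK, hc, hJ]
            module
    obtain ⟨Z, hZ, hJZ, hYZ⟩ := exists_notMem_center_commute_of_semiconjBy_neg hn hF hJ hY0 hJY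
      fun T ↦ hYY ▸ (Commute.one_left T).smul_left _
    exact ⟨Z, hZ, hJZ, hK_comm hJZ hYZ⟩

end ComplexStructure

section RankOneOrComplexStructure

variable {n F : Type*} [Fintype n] [DecidableEq n] [Field F]

/-- The matrices that are the inner vertices of the paths of length four: those of rank one, and,
when `-1` is not a square in `F`, those that make `Fⁿ` a vector space over `F(√-1)`. -/
def IsRankOneOrComplexStructure (X : Matrix n n F) : Prop :=
  (∃ x f : n → F, x ≠ 0 ∧ f ≠ 0 ∧ X = vecMulVec x f) ∨ ¬ IsSquare (-1 : F) ∧ X * X = -1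

theorem IsRankOneOrComplexStructure.notMem_center {X : Matrix n n F} (hn : 2 ≤ Fintype.card n)
    (hX : IsRankOneOrComplexStructure X) : X ∉ Subring.center (Matrix n n F) := by
  have : Nonempty n := Fintype.card_pos_iff.1 (by omega)
  obtain ⟨x, f, hx, hf, rfl⟩ | ⟨hF, hX⟩ := hX
  · have : Nontrivial n := Fintype.one_lt_card_iff_nontrivial.1 hn
    obtain ⟨w, hw, hfw⟩ := exists_ne_zero_dotProduct_eq_zero f
    rw [dotProduct_comm] at hfw
    refine notMem_center_of_mulVec_eq_zero (Matrix.vecMulVec_ne_zero hx hf) hw ?_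
    simp [Matrix.vecMulVec_mulVec, hfw]
  · exact notMem_center_of_mul_self_eq_neg_one hF hX

theorem IsRankOneOrComplexStructure.exists_notMem_center_commute {X Y : Matrix n n F}
    (hn : 3 ≤ Fintype.card n)
    (hX : IsRankOneOrComplexStructure X) (hY : IsRankOneOrComplexStructure Y) :
    ∃ Z ∉ Subring.center (Matrix n n F), Commute X Z ∧ Commute Y Z := by
  obtain ⟨x, f, hx, -, rfl⟩ | ⟨hF, hX⟩ := hX <;> obtain ⟨y, g, hy, -, rfl⟩ | ⟨hF, hY⟩ := hY
  · exact exists_notMem_center_commute_vecMulVec hn hx f y g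
  · exact exists_notMem_center_commute_vecMulVec_of_mul_self hn hF hY hx f
  · obtain ⟨Z, hZ, hYZ, hXZ⟩ := exists_notMem_center_commute_vecMulVec_of_mul_self hn hF hX hy g
    exact ⟨Z, hZ, hXZ, hYZ⟩
  · exact exists_notMem_center_commute_of_mul_self hn hF hX hY

end RankOneOrComplexStructure

theorem ProperExtensionsContainSqrtNegOne.exists_commute_isRankOneOrComplexStructure {n : Type*}
    [Fintype n] [DecidableEq n] [Nonempty n] {F : Type u} [Field F]
    (hF : ProperExtensionsContainSqrtNegOne F) (A : Matrix n n F) :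
    ∃ X, IsRankOneOrComplexStructure X ∧ Commute A X := by
  by_cases hroot : ∃ r, A.charpoly.IsRoot r
  · obtain ⟨r, hr⟩ := hroot
    rw [IsRoot.def, Matrix.eval_charpoly] at hr
    obtain ⟨x, hx, hAx⟩ := Matrix.exists_mulVec_eq_zero_iff.2 hr
    obtain ⟨f, hf, hfA⟩ := Matrix.exists_vecMul_eq_zero_iff.2 hr
    rw [Matrix.scalar_apply, ← Matrix.smul_one_eq_diagonal] at hAx hfA
    refine ⟨_, .inl ⟨x, f, hx, hf, rfl⟩, (commute_vecMulVec_of_mulVec_eq_smul (r := r) ?_ ?_).symm⟩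
    · simpa [Matrix.sub_mulVec, Matrix.smul_mulVec, sub_eq_zero, eq_comm] using hAx
    · simpa [Matrix.vecMul_sub, Matrix.vecMul_smul, sub_eq_zero, eq_comm] using hfA
  · have hdeg : A.charpoly.degree ≠ 0 := by
      simp [Matrix.charpoly_degree_eq_dim]
    obtain ⟨hi, q, hq⟩ := hF.exists_dvd_sq_add_one hdeg (not_exists.1 hroot)
    have hqA : aeval A (q ^ 2 + 1) = 0 :=
      aeval_eq_zero_of_dvd_aeval_eq_zero hq A.aeval_self_charpoly
    refine ⟨aeval A q, .inr ⟨hi, ?_⟩, ?_⟩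
    · rw [← pow_two, ← map_pow]
      exact eq_neg_of_add_eq_zero_left (by simpa using hqA)
    · simpa using (Commute.all X q).map (aeval A)

section UpperShift

variable {n : ℕ} {R : Type*} [CommRing R]

/-- The nilpotent Jordan block of size `n`, with ones on the superdiagonal. Together with its
transpose it realises the diameter of the commuting graph. -/
def upperShift (n : ℕ) (R : Type*) [CommRing R] : Matrix (Fin n) (Fin n) R :=
  Matrix.of fun i j ↦ if (i : ℕ) + 1 = j then 1 else 0

theorem upperShift_apply (i j : Fin n) :
    upperShift n R i j = if (i : ℕ) + 1 = j then 1 else 0 :=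
  rfl

theorem upperShift_pow_apply (k : ℕ) (i j : Fin n) :
    (upperShift n R ^ k) i j = if (i : ℕ) + k = j then 1 else 0 := by
  induction k generalizing j with
  | zero => simp [Matrix.one_apply, Fin.ext_iff]
  | succ k ih =>
    simp only [pow_succ, Matrix.mul_apply, ih, upperShift_apply]
    by_cases h : (i : ℕ) + k < n
    · rw [Finset.sum_eq_single ⟨i + k, h⟩ (by grind) (by simp)]
      simp [add_assoc]
    · rw [Finset.sum_eq_zero (by grind), if_neg (by omega)]

theorem aeval_upperShift_apply (p : R[X]) (i j : Fin n) :
    aeval (upperShift n R) p i j = if i ≤ j then p.coeff (j - i) else 0 := by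
  induction p using Polynomial.induction_on' with
  | add p q hp hq =>
    rw [map_add, Matrix.add_apply, hp, hq]
    split_ifs <;> simp
  | monomial k a =>
    rw [aeval_monomial, ← Algebra.smul_def, Matrix.smul_apply, upperShift_pow_apply,
      coeff_monomial, smul_eq_mul]
    grind

theorem exists_aeval_upperShift_eq_of_commute {P : Matrix (Fin n) (Fin n) R}
    (hP : Commute (upperShift n R) P) (hn : n ≠ 0) :
    ∃ p : R[X], p.natDegree < n ∧ aeval (upperShift n R) p = P := by
  classical
  have := NeZero.mk hn
  refine ⟨ofFn n (P 0), ofFn_natDegree_lt (Nat.one_le_iff_ne_zero.2 hn) _, ?_⟩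
  ext i j
  have hij : (upperShift n R ^ (i : ℕ) * P) 0 j = (P * upperShift n R ^ (i : ℕ)) 0 j := by
    rw [(hP.pow_left i).eq]
  have hrow : (upperShift n R ^ (i : ℕ) * P) 0 j = P i j := by
    simp [Matrix.mul_apply, upperShift_pow_apply, ← Fin.ext_iff]
  rw [aeval_upperShift_apply, ← hrow, hij, Matrix.mul_apply]
  simp only [upperShift_pow_apply, mul_ite, mul_one, mul_zero]
  split_ifs with h
  · have hlt : (j - i : ℕ) < n := by omega
    rw [ofFn_coeff_eq_val_of_lt _ hlt, Finset.sum_eq_single ⟨j - i, hlt⟩ (by grind) (by simp),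
      if_pos (Nat.sub_add_cancel h)]
  · rw [Finset.sum_eq_zero (by grind)]

theorem exists_eq_smul_one_add_aeval_upperShift {P : Matrix (Fin n) (Fin n) R}
    (hP : Commute (upperShift n R) P) (hPc : P ∉ Subring.center (Matrix (Fin n) (Fin n) R)) :
    ∃ (a : R) (p : R[X]), P = a • 1 + aeval (upperShift n R) p ∧ p ≠ 0 ∧ p.coeff 0 = 0 ∧
      p.natDegree < n := by
  have hn : n ≠ 0 := by
    rintro rfl
    exact hPc (Subsingleton.elim P 0 ▸ zero_mem _)
  obtain ⟨p, hpn, rfl⟩ := exists_aeval_upperShift_eq_of_commute hP hn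
  refine ⟨p.coeff 0, p - C (p.coeff 0), ?_, fun h ↦ ?_, by simp, by rwa [natDegree_sub_C]⟩
  · rw [map_sub, aeval_C, Algebra.algebraMap_eq_smul_one, add_sub_cancel]
  · rw [sub_eq_zero.1 h, aeval_C] at hPc
    exact hPc (Subring.mem_center_iff.2 fun M ↦ (Algebra.commutes _ M).symm)

theorem natDegree_lt_natTrailingDegree_of_commute_transpose [IsDomain R] {p q : R[X]} (hp : p ≠ 0)
    (hq : q ≠ 0) (hp0 : p.coeff 0 = 0) (hqn : q.natDegree < n)
    (h : Commute (aeval (upperShift n R) p) (aeval (upperShift n R) q)ᵀ) :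
    q.natDegree < p.natTrailingDegree := by
  by_contra! hle
  -- Compare the entries of the two products at this position.
  let i : Fin n := ⟨q.natDegree - p.natTrailingDegree, by omega⟩
  let z : Fin n := ⟨0, by omega⟩
  have hl : (aeval (upperShift n R) p * (aeval (upperShift n R) q)ᵀ) i z =
      p.trailingCoeff * q.leadingCoeff := by
    rw [Matrix.mul_apply, Finset.sum_eq_single ⟨q.natDegree, hqn⟩]
    · simp [aeval_upperShift_apply, Fin.le_def, i, z, Nat.sub_sub_self hle, trailingCoeff]
    · intro l _ hl
      simp only [aeval_upperShift_apply, Matrix.transpose_apply, Fin.le_def, i, z]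
      obtain (hlt : (l : ℕ) < q.natDegree) | hgt := Nat.lt_or_gt_of_ne (Fin.val_ne_of_ne hl)
      · refine mul_eq_zero_of_left (ite_eq_right_iff.2 fun _ ↦ ?_) _
        exact coeff_eq_zero_of_lt_natTrailingDegree (by omega)
      · rw [coeff_eq_zero_of_natDegree_lt (n := l - 0) hgt, ite_self, mul_zero]
    · simp
  have hr : ((aeval (upperShift n R) q)ᵀ * aeval (upperShift n R) p) i z = 0 := by
    rw [Matrix.mul_apply]
    refine Finset.sum_eq_zero fun j _ ↦ ?_
    rw [aeval_upperShift_apply p, Nat.zero_sub, hp0, ite_self, mul_zero]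
  rw [h.eq, hr] at hl
  exact mul_ne_zero (trailingCoeff_nonzero_iff_nonzero.2 hp) (leadingCoeff_ne_zero.2 hq) hl.symm

theorem not_commute_of_commute_upperShift [IsDomain R] {P Q : Matrix (Fin n) (Fin n) R}
    (hP : Commute (upperShift n R) P) (hQ : Commute Q (upperShift n R)ᵀ)
    (hPc : P ∉ Subring.center (Matrix (Fin n) (Fin n) R))
    (hQc : Q ∉ Subring.center (Matrix (Fin n) (Fin n) R)) : ¬ Commute P Q := by
  intro hPQ
  rw [← Q.transpose_transpose] at hQ hPQ
  rw [commute_transpose_iff] at hQ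
  rw [← transpose_mem_center_iff] at hQc
  obtain ⟨a, p, hPp, hp, hp0, hpn⟩ := exists_eq_smul_one_add_aeval_upperShift hP hPc
  obtain ⟨b, q, hQq, hq, hq0, hqn⟩ := exists_eq_smul_one_add_aeval_upperShift hQ.symm hQc
  have h : Commute (aeval (upperShift n R) p) (aeval (upperShift n R) q)ᵀ := by
    rw [← sub_eq_iff_eq_add'] at hPp hQq
    rw [← hPp, ← hQq, Matrix.transpose_sub, Matrix.transpose_smul, Matrix.transpose_one]
    exact (hPQ.sub_right ((Commute.one_right P).smul_right b)).sub_left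
      ((Commute.one_left _).smul_left a)
  have hqp := natDegree_lt_natTrailingDegree_of_commute_transpose hp hq hp0 hqn h
  have hpq := natDegree_lt_natTrailingDegree_of_commute_transpose hq hp hq0 hpn
    (by simpa using (commute_transpose_iff.2 h).symm)
  exact (hqp.trans_le p.natTrailingDegree_le_natDegree).not_gt
    (hpq.trans_le q.natTrailingDegree_le_natDegree)

theorem upperShift_notMem_center [Nontrivial R] (hn : 2 ≤ n) :
    upperShift n R ∉ Subring.center (Matrix (Fin n) (Fin n) R) := by
  intro hc
  obtain ⟨a, ha⟩ := exists_eq_smul_one_of_mem_center hc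
  simpa [upperShift_apply, Matrix.one_apply, Fin.ext_iff] using
    congrFun₂ ha ⟨0, by omega⟩ ⟨1, by omega⟩

end UpperShift

section CommutingGraph

theorem commutingGraph_edist_le_one {R : Type*} [Ring R] {a b : {a : R // a ∉ Subring.center R}}
    (h : Commute (a : R) b) : (commutingGraph R).edist a b ≤ 1 := by
  rw [SimpleGraph.edist_le_one_iff_adj_or_eq]
  exact or_iff_not_imp_right.2 fun hab ↦ ⟨hab, h⟩

theorem commutingGraph_edist_le_two {R : Type*} [Ring R] {a b : {a : R // a ∉ Subring.center R}}
    {c : R} (hc : c ∉ Subring.center R) (ha : Commute (a : R) c) (hb : Commute (b : R) c) :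
    (commutingGraph R).edist a b ≤ 2 :=
  calc (commutingGraph R).edist a b
      ≤ (commutingGraph R).edist a ⟨c, hc⟩ + (commutingGraph R).edist ⟨c, hc⟩ b :=
        SimpleGraph.edist_triangle
    _ ≤ 1 + 1 := add_le_add (commutingGraph_edist_le_one ha) (commutingGraph_edist_le_one hb.symm)
    _ = 2 := one_add_one_eq_two

theorem exists_commute_of_commutingGraph_edist_lt {R : Type*} [Ring R]
    {a b : {a : R // a ∉ Subring.center R}} (h : (commutingGraph R).edist a b < 4) :
    ∃ p q : {a : R // a ∉ Subring.center R},
      Commute (a : R) p ∧ Commute (p : R) q ∧ Commute (q : R) b := by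
  obtain ⟨w, hw⟩ := SimpleGraph.exists_walk_of_edist_ne_top (ne_top_of_lt h)
  rw [← hw] at h
  have hlen : w.length < 4 := by exact_mod_cast h
  rcases w with _ | ⟨h₁, _ | ⟨h₂, _ | ⟨h₃, _ | ⟨h₄, w⟩⟩⟩⟩
  · exact ⟨a, a, .refl _, .refl _, .refl _⟩
  · exact ⟨a, a, .refl _, .refl _, h₁.2⟩
  · exact ⟨a, _, .refl _, h₁.2, h₂.2⟩
  · exact ⟨_, _, h₁.2, h₂.2, h₃.2⟩
  · simp only [SimpleGraph.Walk.length_cons] at hlen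
    omega

theorem four_le_ediam_commutingGraph {n : ℕ} (hn : 2 ≤ n) (R : Type*) [CommRing R] [IsDomain R] :
    4 ≤ (commutingGraph (Matrix (Fin n) (Fin n) R)).ediam := by
  have hN : upperShift n R ∉ Subring.center (Matrix (Fin n) (Fin n) R) :=
    upperShift_notMem_center hn
  refine le_trans ?_ (SimpleGraph.edist_le_ediam (u := ⟨_, hN⟩)
    (v := ⟨_, transpose_mem_center_iff.not.2 hN⟩))
  by_contra! hlt
  obtain ⟨P, Q, hNP, hPQ, hQN⟩ := exists_commute_of_commutingGraph_edist_lt hlt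
  exact not_commute_of_commute_upperShift hNP hQN P.2 Q.2 hPQ

end CommutingGraph

theorem ediam_commutingGraph_le_four {n : Type*} [Fintype n] [DecidableEq n]
    (hn : 3 ≤ Fintype.card n) {F : Type u} [Field F] (hF : ProperExtensionsContainSqrtNegOne F) :
    (commutingGraph (Matrix n n F)).ediam ≤ 4 := by
  refine SimpleGraph.ediam_le_of_edist_le fun A B ↦ ?_
  have : Nonempty n := Fintype.card_pos_iff.1 (by omega)
  obtain ⟨X, hX, hAX⟩ := hF.exists_commute_isRankOneOrComplexStructure A.1
  obtain ⟨Y, hY, hBY⟩ := hF.exists_commute_isRankOneOrComplexStructure B.1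
  obtain ⟨Z, hZ, hXZ, hYZ⟩ := hX.exists_notMem_center_commute hn hY
  calc (commutingGraph (Matrix n n F)).edist A B
      ≤ (commutingGraph (Matrix n n F)).edist A ⟨Z, hZ⟩ +
          (commutingGraph (Matrix n n F)).edist ⟨Z, hZ⟩ B := SimpleGraph.edist_triangle
    _ ≤ 2 + 2 := add_le_add
        (commutingGraph_edist_le_two (hX.notMem_center (by omega)) hAX hXZ.symm)
        (commutingGraph_edist_le_two (hY.notMem_center (by omega)) hYZ.symm hBY)
    _ = 4 := two_add_two_eq_four

theorem theorem1p1_general (F : Type*) [Field F] (hF : ProperExtensionsContainSqrtNegOne F)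
    (n : ℕ) (hn : 3 ≤ n) :
    (commutingGraph (Matrix (Fin n) (Fin n) F)).Connected ∧
      (commutingGraph (Matrix (Fin n) (Fin n) F)).ediam = 4 := by
  have hle : (commutingGraph (Matrix (Fin n) (Fin n) F)).ediam ≤ 4 :=
    ediam_commutingGraph_le_four (by rwa [Fintype.card_fin]) hF
  have : Nonempty {A : Matrix (Fin n) (Fin n) F // A ∉ Subring.center _} :=
    ⟨⟨upperShift n F, upperShift_notMem_center (by omega)⟩⟩
  exact ⟨SimpleGraph.connected_of_ediam_ne_top (ne_top_of_le_ne_top (by decide) hle),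
    hle.antisymm (four_le_ediam_commutingGraph (by omega) F)⟩

theorem theorem1p1 (F : Type*) [Field F] (hF : FiniteDimensional F (AlgebraicClosure F))
    (n : ℕ) (hn : 3 ≤ n) :
    (commutingGraph (Matrix (Fin n) (Fin n) F)).Connected ∧
      (commutingGraph (Matrix (Fin n) (Fin n) F)).ediam = 4 :=
  theorem1p1_general F (properExtensionsContainSqrtNegOne_of_isAlgClosed (AlgebraicClosure F)) n hn
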